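/- Let $S$ and $A$ be measurable spaces of states and actions, $\mu_0$ an initial state distribution on $S$ and $\gamma\in(0,1)$ a discount factor. A model is a jointly measurable function $P(s',r\mid s,a)\ge 0$ that is, for each $(s,a)$, a probability density of the next state $s'$ and the reward $r\in\mathbb R$ with respect to a fixed s-finite reference kernel $\nu(ds',dr\mid s,a)$ (for instance a counting measure, for discrete models). For a Markovian policy $\pi$ (a Markov kernel from $S$ to $A$) let $V^\pi_P=\mathbb E_{\pi,P}\big[\sum_{t\ge 0}\gamma^t r_t\big]$ be the expected discounted return when $s_0\sim\mu_0$, $a_t\sim\pi(\cdot\mid s_t)$ and $(s_{t+1},r_t)\sim P(\cdot\mid s_t,a_t)$. Let $\mathcal M$ be a class of models that contains the true model $T$, and let $\mathcal D=\{(s_i,a_i,r_i,s_i')\}_{i=1}^n$, $n\ge1$, consist of independent transitions with $(s_i,a_i)\sim\rho$ and $(s_i',r_i)\sim T(\cdot\mid s_i,a_i)$, for a probability distribution $\rho$ on $S\times A$. Let $\widehat T_{\mathrm{MLE}}\in\mathcal M$ be any maximizer over $\mathcal M$ of the likelihood $\prod_{i=1}^n P(s_i',r_i\mid s_i,a_i)$,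 and for $\xi>0$ let $$\mathcal M_{\mathcal D}=\Big\{\widehat T\in\mathcal M\ :\ \frac1n\sum_{i=1}^n \mathrm{TV}\big(\widehat T_{\mathrm{MLE}}(\cdot\mid s_i,a_i),\widehat T(\cdot\mid s_i,a_i)\big)^2\le\xi\Big\},\qquad \mathrm{TV}(P_1,P_2)=\sup_B|P_1(B)-P_2(B)| .$$ Let $\delta\in(0,1)$ and $\varepsilon\ge0$, and suppose that $\mathcal M$ is covered by $N$ brackets of width at most $\varepsilon$: there are measurable functions $0\le l_j\le u_j<\infty$, $j=1,\dots,N$, with $\int\!\!\int (u_j-l_j)\,d\nu(\cdot\mid s,a)\,d\rho(s,a)\le\varepsilon$ such that every $P\in\mathcal M$ satisfies $l_j\le P\le u_j$ everywhere for some $j$. (If $\mathcal M$ is finite, this holds with $N=|\mathcal M|$ and $\varepsilon=0$.) Suppose that $$\xi\ \ge\ 16\Big(\frac{\ln(2N/\delta)}{n}+\varepsilon\Big).$$ Then for any policy $\pi$ for which $\sum_{t\ge 0}\gamma^t|r_t|$ has finite expectation in every model of $\mathcal M$ (for instance, if rewards are bounded), with probability at least $1-\delta$ over $\mathcal D$,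 for every choice of $\widehat T_{\mathrm{MLE}}$, $$\inf_{\widehat T\in\mathcal M_{\mathcal D}}V^\pi_{\widehat T}\ \le\ V^\pi_T .$$ The infimum is over a nonempty set, and it is a minimum whenever it is attained, in particular if $\mathcal M$ is finite. -/

import Mathlib

open MeasureTheory ProbabilityTheory
open scoped NNReal ENNReal

namespace OfflineRL

/-- A model of the environment: for each state-action pair `x = (s, a)`, a probability density of
the joint outcome `y = (s', r)` (next state and reward) with respect to the reference measure
`ν x`. Counting measures give discrete models; the reference measure may depend on `(s, a)`, so
that for instance a known deterministic reward `r = R(s, a)` is covered as well. -/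
structure Model {S A : Type*} [MeasurableSpace S] [MeasurableSpace A]
    (ν : Kernel (S × A) (S × ℝ)) where
  density : S × A → S × ℝ → ℝ≥0
  measurable_density : Measurable (Function.uncurry density)
  lintegral_density : ∀ x, ∫⁻ y, density x y ∂(ν x) = 1

section

variable {S A : Type*} [MeasurableSpace S] [MeasurableSpace A]
  {ν : Kernel (S × A) (S × ℝ)} [IsSFiniteKernel ν]

/-- The transition kernel `P(s', r | s, a)` of a model. -/
noncomputable def Model.kernel (P : Model ν) : Kernel (S × A) (S × ℝ) :=
  ν.withDensity fun x y => (P.density x y : ℝ≥0∞)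

instance (P : Model ν) : IsMarkovKernel P.kernel where
  isProbabilityMeasure x := by
    have hm : Measurable (Function.uncurry fun x y => (P.density x y : ℝ≥0∞)) :=
      measurable_coe_nnreal_ennreal.comp P.measurable_density
    constructor
    rw [Model.kernel, Kernel.withDensity_apply' _ hm, setLIntegral_univ]
    exact P.lintegral_density x

/-- One transition `((s, a), (s', r))` from the state `s`: `a ∼ π(· | s)`, `(s', r) ∼ P(· | s, a)`. -/
noncomputable def stepKernel (π : Kernel S A) (P : Model ν) :
    Kernel S ((S × A) × (S × ℝ)) :=
  (Kernel.id ×ₖ π) ⊗ₖ (Kernel.prodMkLeft S P.kernel)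

instance (π : Kernel S A) [IsMarkovKernel π] (P : Model ν) :
    IsMarkovKernel (stepKernel π P) := by
  unfold stepKernel
  infer_instance

/-- The transition at time `n + 1` given the transitions up to time `n`: it starts in the state
reached by the transition at time `n`. -/
noncomputable def nextKernel (π : Kernel S A) (P : Model ν) (n : ℕ) :
    Kernel ((_ : Finset.Iic n) → (S × A) × (S × ℝ)) ((S × A) × (S × ℝ)) :=
  (stepKernel π P).comap (fun h => (h ⟨n, Finset.mem_Iic.2 le_rfl⟩).2.1) (by fun_prop)

instance (π : Kernel S A) [IsMarkovKernel π] (P : Model ν) (n : ℕ) :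
    IsMarkovKernel (nextKernel π P n) := by
  unfold nextKernel
  infer_instance

/-- The law of the infinite trajectory of transitions `((s_t, a_t), (s_{t+1}, r_t))` when `π` is
executed in the model `P` from `s_0 ∼ μ₀`. -/
noncomputable def trajectoryLaw (μ₀ : Measure S) (π : Kernel S A) [IsMarkovKernel π]
    (P : Model ν) : Measure (ℕ → (S × A) × (S × ℝ)) :=
  Kernel.trajMeasure (X := fun _ => (S × A) × (S × ℝ)) (stepKernel π P ∘ₘ μ₀) (nextKernel π P)

/-- The value is well defined: the discounted sum of rewards converges absolutely in expectation. -/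
def HasValue (μ₀ : Measure S) (γ : ℝ) (π : Kernel S A) [IsMarkovKernel π] (P : Model ν) : Prop :=
  ∫⁻ ω, ∑' t, ‖γ ^ t * (ω t).2.2‖ₑ ∂(trajectoryLaw μ₀ π P) < ∞

/-- The value `V^π_P`: the expected discounted return `∑ₜ γ ^ t * r_t` of `π` in the model `P`. -/
noncomputable def value (μ₀ : Measure S) (γ : ℝ) (π : Kernel S A) [IsMarkovKernel π]
    (P : Model ν) : ℝ :=
  ∫ ω, ∑' t, γ ^ t * (ω t).2.2 ∂(trajectoryLaw μ₀ π P)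

/-- The total variation distance `sup_B |μ B - μ' B|` of two probability measures. -/
noncomputable def tvDist {Ω : Type*} [MeasurableSpace Ω] (μ μ' : Measure Ω) : ℝ :=
  ⨆ B : {B : Set Ω // MeasurableSet B}, |μ.real B.1 - μ'.real B.1|

/-- The law of a dataset of `n` independent transitions `((s_i, a_i), (s_i', r_i))` with
`(s_i, a_i) ∼ ρ` and `(s_i', r_i) ∼ T(· | s_i, a_i)`. -/
noncomputable def datasetLaw (ρ : Measure (S × A)) (T : Model ν) (n : ℕ) :
    Measure (Fin n → (S × A) × (S × ℝ)) :=
  Measure.pi fun _ => ρ ⊗ₘ T.kernel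

/-- `P` is a maximum likelihood estimate in the class `M` for the dataset `D`. -/
def IsMLE (M : Set (Model ν)) {n : ℕ} (D : Fin n → (S × A) × (S × ℝ)) (P : Model ν) : Prop :=
  P ∈ M ∧ ∀ Q ∈ M, ∏ i, Q.density (D i).1 (D i).2 ≤ ∏ i, P.density (D i).1 (D i).2

/-- The models in `M` whose squared total variation distance to `Pmle`, averaged over the
state-action pairs of the dataset `D`, is at most `ξ`. -/
def plausibleModels (M : Set (Model ν)) (ξ : ℝ) {n : ℕ} (D : Fin n → (S × A) × (S × ℝ))
    (Pmle : Model ν) : Set (Model ν) :=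
  {P ∈ M | (∑ i, tvDist (Pmle.kernel (D i).1) (P.kernel (D i).1) ^ 2) / n ≤ ξ}

/-- `M` is covered by `N` brackets `[l j, u j]` of `L¹(ρ ⊗ ν)`-width at most `ε`. A class of `N`
models is covered by `N` brackets of width `0`. -/
def HasBracketing (ρ : Measure (S × A)) (M : Set (Model ν)) (ε : ℝ) (N : ℕ) : Prop :=
  ∃ l u : Fin N → S × A → S × ℝ → ℝ≥0,
    (∀ j, Measurable (Function.uncurry (l j)) ∧ Measurable (Function.uncurry (u j))) ∧
    (∀ j x y, l j x y ≤ u j x y) ∧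
    (∀ j, ∫⁻ x, ∫⁻ y, ((u j x y - l j x y : ℝ≥0) : ℝ≥0∞) ∂(ν x) ∂ρ ≤ ENNReal.ofReal ε) ∧
    ∀ P ∈ M, ∃ j, ∀ x y, l j x y ≤ P.density x y ∧ P.density x y ≤ u j x y

end

end OfflineRL

/-! The infimum is at most the value at `T` once `T` is plausible, so everything reduces to a
likelihood bound: with probability at least 1 - δ, every MLE is within ξ of `T` in empirical squared
TV. For a bracket `[l, u]`, normalize √(u/t) at each state-action pair x by its conditional mean
under `T`, the affinity, and multiply by 1 + width(x). Products of these scores over the data have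
mean at most exp(nε) (`lintegral_bracketScore_le`), so Markov's inequality and a union bound keep
all N products below (N/δ)exp(nε). If an MLE lies in `[l, u]`, the likelihood ratio of `u` to `T` is
at least 1, while each remaining factor is at least exp(TV²/16) (`exp_sq_tvDist_mul_affinity_le`).
Taking logarithms bounds the sum of TV². Because the normalization is done at each x, the bound
concerns the sampled pairs directly, with no passage from population to empirical averages. -/

namespace OfflineRL

/-! ### Total variation and Hellinger affinity of densities -/

section

variable {Y : Type*} [MeasurableSpace Y] {m : Measure Y}

lemma tvDist_nonneg (μ μ' : Measure Y) : 0 ≤ tvDist μ μ' :=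
  Real.iSup_nonneg fun _ => abs_nonneg _

lemma tvDist_le_one (μ μ' : Measure Y) [IsProbabilityMeasure μ] [IsProbabilityMeasure μ'] :
    tvDist μ μ' ≤ 1 := by
  have : Nonempty {B : Set Y // MeasurableSet B} := ⟨⟨∅, .empty⟩⟩
  refine ciSup_le fun B => abs_le.2 ⟨?_, ?_⟩ <;>
  linarith [measureReal_nonneg (μ := μ) (s := B.1), measureReal_nonneg (μ := μ') (s := B.1),
    measureReal_le_one (μ := μ) (s := B.1), measureReal_le_one (μ := μ') (s := B.1)]

lemma integrable_coe_of_lintegral_ne_top {p : Y → ℝ≥0} (hp : Measurable p)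
    (h : ∫⁻ y, p y ∂m ≠ ∞) : Integrable (fun y => (p y : ℝ)) m := by
  refine ⟨by fun_prop, ?_⟩
  simpa [HasFiniteIntegral, enorm_eq_nnnorm] using h.lt_top

lemma integral_coe_eq_toReal_lintegral {p : Y → ℝ≥0} (hp : Measurable p) :
    ∫ y, (p y : ℝ) ∂m = (∫⁻ y, p y ∂m).toReal := by
  rw [integral_eq_lintegral_of_nonneg_ae (ae_of_all _ fun y => NNReal.coe_nonneg (p y))
    (by fun_prop)]
  simp

lemma real_withDensity_apply {p : Y → ℝ≥0} (hp : Measurable p) {B : Set Y}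
    (hB : MeasurableSet B) :
    (m.withDensity fun y => (p y : ℝ≥0∞)).real B = ∫ y in B, (p y : ℝ) ∂m := by
  rw [Measure.real, withDensity_apply _ hB, integral_coe_eq_toReal_lintegral hp]

/-- The total variation distance is at most half the `L¹` distance of the densities. -/
lemma two_mul_tvDist_withDensity_le {p t : Y → ℝ≥0} (hp : Measurable p) (ht : Measurable t)
    (hp1 : ∫⁻ y, p y ∂m = 1) (ht1 : ∫⁻ y, t y ∂m = 1) :
    2 * tvDist (m.withDensity fun y => (p y : ℝ≥0∞)) (m.withDensity fun y => (t y : ℝ≥0∞)) ≤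
      ∫ y, |(p y : ℝ) - t y| ∂m := by
  have hpi : Integrable (fun y => (p y : ℝ)) m :=
    integrable_coe_of_lintegral_ne_top hp (by simp [hp1])
  have hti : Integrable (fun y => (t y : ℝ)) m :=
    integrable_coe_of_lintegral_ne_top ht (by simp [ht1])
  have hd : Integrable (fun y => (p y : ℝ) - t y) m := hpi.sub hti
  suffices h : tvDist (m.withDensity fun y => (p y : ℝ≥0∞))
      (m.withDensity fun y => (t y : ℝ≥0∞)) ≤ (∫ y, |(p y : ℝ) - t y| ∂m) / 2 by linarith
  have : Nonempty {B : Set Y // MeasurableSet B} := ⟨⟨∅, .empty⟩⟩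
  refine ciSup_le fun ⟨B, hB⟩ => ?_
  rw [real_withDensity_apply hp hB, real_withDensity_apply ht hB,
    ← integral_sub hpi.integrableOn hti.integrableOn]
  -- Equal total masses make the integrals over `B` and its complement opposite, which yields the
  -- factor 2.
  have h0 : ∫ y, ((p y : ℝ) - t y) ∂m = 0 := by
    rw [integral_sub hpi hti, integral_coe_eq_toReal_lintegral hp,
      integral_coe_eq_toReal_lintegral ht, hp1, ht1, sub_self]
  have h1 := integral_add_compl hB hd
  have h2 := integral_add_compl hB hd.abs
  have h3 := abs_integral_le_integral_abs (f := fun y => (p y : ℝ) - t y) (μ := m.restrict B)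
  have h4 := abs_integral_le_integral_abs (f := fun y => (p y : ℝ) - t y) (μ := m.restrict Bᶜ)
  have h5 : ∫ y in Bᶜ, ((p y : ℝ) - t y) ∂m = -∫ y in B, ((p y : ℝ) - t y) ∂m := by linarith
  rw [h5, abs_neg] at h4
  linarith

/-- Cauchy-Schwarz comparison of the `L¹` distance with the Hellinger affinity. -/
lemma sq_integral_abs_sub_le {u t : Y → ℝ} (hu0 : ∀ y, 0 ≤ u y) (ht0 : ∀ y, 0 ≤ t y)
    (hu : Integrable u m) (ht : Integrable t m)
    (hz : Integrable (fun y => √(u y) * √(t y)) m) :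
    (∫ y, |u y - t y| ∂m) ^ 2 ≤
      (∫ y, u y ∂m + ∫ y, t y ∂m) ^ 2 - 4 * (∫ y, √(u y) * √(t y) ∂m) ^ 2 := by
  set a := ∫ y, |u y - t y| ∂m
  set U := ∫ y, u y ∂m
  set V := ∫ y, t y ∂m
  set Z := ∫ y, √(u y) * √(t y) ∂m
  -- This is the integral of (|√u - √t| - c(√u + √t))²; its discriminant in c gives Cauchy-Schwarz.
  have key : ∀ c : ℝ, 0 ≤ (U + V - 2 * Z) - 2 * c * a + c ^ 2 * (U + V + 2 * Z) := by
    intro c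
    have h1 : Integrable (fun y => u y + t y) m := hu.add ht
    have h2 : Integrable (fun y => 2 * (√(u y) * √(t y))) m := hz.const_mul 2
    have h3 : Integrable (fun y => 2 * c * |u y - t y|) m := (hu.sub ht).abs.const_mul (2 * c)
    have h4 : Integrable (fun y => u y + t y - 2 * (√(u y) * √(t y))) m := h1.sub h2
    have h5 : Integrable (fun y => u y + t y + 2 * (√(u y) * √(t y))) m := h1.add h2
    have h6 : Integrable (fun y => u y + t y - 2 * (√(u y) * √(t y)) - 2 * c * |u y - t y|) m :=
      h4.sub h3
    have he : (U + V - 2 * Z) - 2 * c * a + c ^ 2 * (U + V + 2 * Z) =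
        ∫ y, (u y + t y - 2 * (√(u y) * √(t y)) - 2 * c * |u y - t y| +
          c ^ 2 * (u y + t y + 2 * (√(u y) * √(t y)))) ∂m := by
      rw [integral_add h6 (h5.const_mul (c ^ 2)), integral_sub h4 h3, integral_sub h1 h2,
        integral_const_mul, integral_const_mul, integral_const_mul, integral_add h1 h2,
        integral_add hu ht, integral_const_mul]
    rw [he]
    refine integral_nonneg fun y => ?_
    have hsu := Real.mul_self_sqrt (hu0 y)
    have hst := Real.mul_self_sqrt (ht0 y)
    have hab : |u y - t y| = |√(u y) - √(t y)| * (√(u y) + √(t y)) := by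
      rw [← abs_of_nonneg (add_nonneg (Real.sqrt_nonneg (u y)) (Real.sqrt_nonneg (t y))),
        ← abs_mul]
      congr 1
      linear_combination -hsu + hst
    have hsq := sq_abs (√(u y) - √(t y))
    have : u y + t y - 2 * (√(u y) * √(t y)) - 2 * c * |u y - t y| +
          c ^ 2 * (u y + t y + 2 * (√(u y) * √(t y))) =
        (|√(u y) - √(t y)| - c * (√(u y) + √(t y))) ^ 2 := by
      rw [hab]
      linear_combination (-1 - c ^ 2) * hsu + (-1 - c ^ 2) * hst - hsq
    simp only [Pi.zero_apply]
    rw [this]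
    positivity
  have hd := discrim_le_zero (a := U + V + 2 * Z) (b := -(2 * a)) (c := U + V - 2 * Z)
    fun c => by linarith [key c]
  rw [discrim] at hd
  linarith

/-- Here τ is the TV distance of p and t, a the L¹ distance of u and t, v the mass of u - p, and Z
the affinity of u and t. The 16 arises from Z² ≤ (1 - τ²/8)(1 + v)² and 1 - x ≤ exp(-x), after a
square root. -/
lemma exp_mul_le_one_add {τ a v Z : ℝ} (hτ0 : 0 ≤ τ) (hτ1 : τ ≤ 1) (hv : 0 ≤ v)
    (ha : a ^ 2 ≤ (1 + v + 1) ^ 2 - 4 * Z ^ 2) (hτ : 2 * τ ≤ a + v) :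
    Real.exp (τ ^ 2 / 16) * Z ≤ 1 + v := by
  have h1 : τ ^ 2 ≤ 1 := by nlinarith
  have h2 : 4 * τ ^ 2 ≤ (a + v) ^ 2 := by nlinarith
  have h3 : 2 * τ ^ 2 ≤ a ^ 2 + v ^ 2 := by nlinarith [sq_nonneg (a - v)]
  have h4 : Z ^ 2 ≤ (1 - τ ^ 2 / 8) * (1 + v) ^ 2 := by
    nlinarith [mul_le_mul_of_nonneg_right h1 (by positivity : 0 ≤ 2 * v + v ^ 2), sq_nonneg a]
  have h5 : Real.exp (τ ^ 2 / 8) * (1 - τ ^ 2 / 8) ≤ 1 := by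
    have := Real.one_sub_le_exp_neg (τ ^ 2 / 8)
    calc _ ≤ Real.exp (τ ^ 2 / 8) * Real.exp (-(τ ^ 2 / 8)) := by gcongr
      _ = 1 := by rw [← Real.exp_add]; simp
  refine le_of_sq_le_sq ?_ (by positivity)
  have h6 : Real.exp (τ ^ 2 / 16) ^ 2 = Real.exp (τ ^ 2 / 8) := by
    rw [← Real.exp_nat_mul]; congr 1; push_cast; ring
  rw [mul_pow, h6]
  calc Real.exp (τ ^ 2 / 8) * Z ^ 2
      ≤ Real.exp (τ ^ 2 / 8) * ((1 - τ ^ 2 / 8) * (1 + v) ^ 2) := by gcongr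
    _ = (Real.exp (τ ^ 2 / 8) * (1 - τ ^ 2 / 8)) * (1 + v) ^ 2 := by ring
    _ ≤ 1 * (1 + v) ^ 2 := by gcongr
    _ = _ := one_mul _

/-- If the density `p` lies in the bracket `[l, u]`, the affinity of `u` and `t` decreases with the
total variation distance of `p` and `t`, up to the width of the bracket. -/
lemma exp_sq_tvDist_mul_affinity_le {p t l u : Y → ℝ≥0} (hp : Measurable p) (ht : Measurable t)
    (hu : Measurable u) (hp1 : ∫⁻ y, p y ∂m = 1) (ht1 : ∫⁻ y, t y ∂m = 1)
    (hlp : ∀ y, l y ≤ p y) (hpu : ∀ y, p y ≤ u y) :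
    ENNReal.ofReal (Real.exp (tvDist (m.withDensity fun y => (p y : ℝ≥0∞))
        (m.withDensity fun y => (t y : ℝ≥0∞)) ^ 2 / 16)) *
      ∫⁻ y, NNReal.sqrt (u y * t y) ∂m ≤ 1 + ∫⁻ y, ((u y - l y : ℝ≥0) : ℝ≥0∞) ∂m := by
  have hup : ∫⁻ y, u y ∂m = 1 + ∫⁻ y, ((u y - p y : ℝ≥0) : ℝ≥0∞) ∂m := by
    rw [← hp1, ← lintegral_add_left (by fun_prop)]
    refine lintegral_congr fun y => ?_
    rw [← ENNReal.coe_add, add_tsub_cancel_of_le (hpu y)]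
  have hle : ∫⁻ y, ((u y - p y : ℝ≥0) : ℝ≥0∞) ∂m ≤ ∫⁻ y, ((u y - l y : ℝ≥0) : ℝ≥0∞) ∂m :=
    lintegral_mono fun y => ENNReal.coe_le_coe.2 (tsub_le_tsub_left (hlp y) _)
  refine le_trans ?_ (add_le_add_right hle 1)
  by_cases hw : ∫⁻ y, ((u y - p y : ℝ≥0) : ℝ≥0∞) ∂m = ∞
  · rw [hw, add_top]; exact le_top
  have : IsProbabilityMeasure (m.withDensity fun y => (p y : ℝ≥0∞)) := ⟨by simp [hp1]⟩
  have : IsProbabilityMeasure (m.withDensity fun y => (t y : ℝ≥0∞)) := ⟨by simp [ht1]⟩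
  have hpi : Integrable (fun y => (p y : ℝ)) m :=
    integrable_coe_of_lintegral_ne_top hp (by simp [hp1])
  have hti : Integrable (fun y => (t y : ℝ)) m :=
    integrable_coe_of_lintegral_ne_top ht (by simp [ht1])
  have hui : Integrable (fun y => (u y : ℝ)) m :=
    integrable_coe_of_lintegral_ne_top hu (by rw [hup]; exact ENNReal.add_ne_top.2 ⟨ENNReal.one_ne_top, hw⟩)
  have hzc : ∀ y, ((NNReal.sqrt (u y * t y) : ℝ≥0) : ℝ) = √(u y) * √(t y) := fun y => by
    rw [Real.coe_sqrt, NNReal.coe_mul, Real.sqrt_mul (NNReal.coe_nonneg (u y))]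
  have hzi : Integrable (fun y => √(u y : ℝ) * √(t y : ℝ)) m := by
    refine (hui.add hti).mono' (by fun_prop) (ae_of_all _ fun y => ?_)
    rw [Real.norm_of_nonneg (by positivity), Pi.add_apply]
    nlinarith [Real.mul_self_sqrt (NNReal.coe_nonneg (u y)),
      Real.mul_self_sqrt (NNReal.coe_nonneg (t y)),
      sq_nonneg (√(u y : ℝ) - √(t y : ℝ)), sq_nonneg (√(u y : ℝ) + √(t y : ℝ))]
  have hZ : ∫⁻ y, NNReal.sqrt (u y * t y) ∂m =
      ENNReal.ofReal (∫ y, √(u y : ℝ) * √(t y : ℝ) ∂m) := by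
    rw [ofReal_integral_eq_lintegral_ofReal hzi (ae_of_all _ fun y => by positivity)]
    refine lintegral_congr fun y => ?_
    rw [← hzc, ENNReal.ofReal_coe_nnreal]
  set v := (∫⁻ y, ((u y - p y : ℝ≥0) : ℝ≥0∞) ∂m).toReal with hv
  have hv' : ∫⁻ y, ((u y - p y : ℝ≥0) : ℝ≥0∞) ∂m = ENNReal.ofReal v := by
    rw [hv, ENNReal.ofReal_toReal hw]
  have hv0 : 0 ≤ v := ENNReal.toReal_nonneg
  have hU : ∫ y, (u y : ℝ) ∂m = 1 + v := by
    rw [integral_coe_eq_toReal_lintegral hu, hup, ENNReal.toReal_add (by simp) hw]; simp [hv]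
  have hP : ∫ y, (p y : ℝ) ∂m = 1 := by
    rw [integral_coe_eq_toReal_lintegral hp, hp1]; simp
  have hT : ∫ y, (t y : ℝ) ∂m = 1 := by
    rw [integral_coe_eq_toReal_lintegral ht, ht1]; simp
  have hcs := sq_integral_abs_sub_le (fun y => NNReal.coe_nonneg (u y))
    (fun y => NNReal.coe_nonneg (t y)) hui hti hzi
  -- Replacing p by the upper bracket u costs only the mass v of u - p.
  have htri : ∫ y, |(p y : ℝ) - t y| ∂m ≤ ∫ y, |(u y : ℝ) - t y| ∂m + v := by
    have hv2 : v = ∫ y, ((u y : ℝ) - p y) ∂m := by rw [integral_sub hui hpi, hU, hP]; ring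
    have hi1 : Integrable (fun y => |(u y : ℝ) - t y|) m := (hui.sub hti).abs
    have hi2 : Integrable (fun y => (u y : ℝ) - p y) m := hui.sub hpi
    rw [hv2, ← integral_add hi1 hi2]
    refine integral_mono (hpi.sub hti).abs (hi1.add hi2) fun y => ?_
    have h1 : (p y : ℝ) ≤ u y := hpu y
    change |(p y : ℝ) - t y| ≤ |(u y : ℝ) - t y| + ((u y : ℝ) - p y)
    have h2 := abs_sub_le (p y : ℝ) (u y) (t y)
    rw [abs_sub_comm (p y : ℝ) (u y), abs_of_nonneg (sub_nonneg.2 h1)] at h2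
    linarith
  have h2 := two_mul_tvDist_withDensity_le hp ht hp1 ht1
  rw [hU, hT] at hcs
  rw [hZ, hv', ← ENNReal.ofReal_mul (by positivity), ← ENNReal.ofReal_one,
    ← ENNReal.ofReal_add zero_le_one hv0]
  exact ENNReal.ofReal_le_ofReal (exp_mul_le_one_add (tvDist_nonneg _ _) (tvDist_le_one _ _) hv0
    hcs (h2.trans htri))

end

/-! ### Bracket scores and their mean under the true model -/

section

variable {S A : Type*} [MeasurableSpace S] [MeasurableSpace A]
  {ν : Kernel (S × A) (S × ℝ)}

/-- The `ν x`-width of the bracket `[l, u]` at `x`. -/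
noncomputable def bracketWidth (ν : Kernel (S × A) (S × ℝ)) (l u : S × A → S × ℝ → ℝ≥0)
    (x : S × A) : ℝ≥0∞ :=
  ∫⁻ y, ((u x y - l x y : ℝ≥0) : ℝ≥0∞) ∂(ν x)

/-- The Hellinger affinity `∫ √(u t) dν` at `x`. -/
noncomputable def affinity (ν : Kernel (S × A) (S × ℝ)) (t u : S × A → S × ℝ → ℝ≥0)
    (x : S × A) : ℝ≥0∞ :=
  ∫⁻ y, NNReal.sqrt (u x y * t x y) ∂(ν x)

/-- The root likelihood ratio of the upper bracket `u` and `t`, renormalized by the affinity. -/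
noncomputable def bracketScore (ν : Kernel (S × A) (S × ℝ)) (t l u : S × A → S × ℝ → ℝ≥0)
    (z : (S × A) × (S × ℝ)) : ℝ≥0∞ :=
  NNReal.sqrt (u z.1 z.2 / t z.1 z.2) * ((1 + bracketWidth ν l u z.1) / affinity ν t u z.1)

variable [IsSFiniteKernel ν]

lemma measurable_bracketWidth {l u : S × A → S × ℝ → ℝ≥0}
    (hl : Measurable (Function.uncurry l)) (hu : Measurable (Function.uncurry u)) :
    Measurable (bracketWidth ν l u) :=
  Measurable.lintegral_kernel_prod_right (hu.sub hl).coe_nnreal_ennreal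

lemma measurable_affinity {t u : S × A → S × ℝ → ℝ≥0}
    (ht : Measurable (Function.uncurry t)) (hu : Measurable (Function.uncurry u)) :
    Measurable (affinity ν t u) :=
  Measurable.lintegral_kernel_prod_right
    (NNReal.continuous_sqrt.measurable.comp (hu.mul ht)).coe_nnreal_ennreal

lemma measurable_bracketScore {t l u : S × A → S × ℝ → ℝ≥0}
    (ht : Measurable (Function.uncurry t)) (hl : Measurable (Function.uncurry l))
    (hu : Measurable (Function.uncurry u)) : Measurable (bracketScore ν t l u) :=
  (NNReal.continuous_sqrt.measurable.comp (hu.div ht)).coe_nnreal_ennreal.mul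
    (((measurable_bracketWidth hl hu).const_add 1).div (measurable_affinity ht hu) |>.comp
      measurable_fst)

lemma lintegral_model_kernel (T : Model ν) (x : S × A) {g : S × ℝ → ℝ≥0∞} (hg : Measurable g) :
    ∫⁻ y, g y ∂(T.kernel x) = ∫⁻ y, T.density x y * g y ∂(ν x) :=
  Kernel.lintegral_withDensity (f := fun x y => (T.density x y : ℝ≥0∞)) ν
    T.measurable_density.coe_nnreal_ennreal x hg

lemma model_kernel_apply (T : Model ν) (x : S × A) :
    T.kernel x = (ν x).withDensity fun y => (T.density x y : ℝ≥0∞) :=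
  Kernel.withDensity_apply (f := fun x y => (T.density x y : ℝ≥0∞)) ν
    T.measurable_density.coe_nnreal_ennreal x

/-- Given x, the mean of √(u/t) under `T` is at most the affinity, so the score has conditional mean
at most 1 + width(x). Averaging over ρ gives 1 + ε ≤ exp ε. -/
lemma lintegral_bracketScore_le (T : Model ν) (ρ : Measure (S × A)) [IsProbabilityMeasure ρ]
    {l u : S × A → S × ℝ → ℝ≥0} (hl : Measurable (Function.uncurry l))
    (hu : Measurable (Function.uncurry u)) {ε : ℝ} (hε : 0 ≤ ε)
    (hw : ∫⁻ x, bracketWidth ν l u x ∂ρ ≤ ENNReal.ofReal ε) :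
    ∫⁻ z, bracketScore ν T.density l u z ∂(ρ ⊗ₘ T.kernel) ≤ ENNReal.ofReal (Real.exp ε) := by
  have ht := T.measurable_density
  have hm := measurable_bracketScore (ν := ν) ht hl hu
  rw [Measure.lintegral_compProd hm]
  calc _ ≤ ∫⁻ x, (1 + bracketWidth ν l u x) ∂ρ := by
        refine lintegral_mono fun x => ?_
        rw [lintegral_model_kernel T x (g := fun y => bracketScore ν T.density l u (x, y))
          (hm.comp measurable_prodMk_left)]
        simp only [bracketScore]
        have hux : Measurable (u x) := hu.comp measurable_prodMk_left
        have htx : Measurable (T.density x) := ht.comp measurable_prodMk_left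
        have hs : Measurable fun y => NNReal.sqrt (u x y * T.density x y) :=
          NNReal.continuous_sqrt.measurable.comp (hux.mul htx)
        calc _ ≤ ∫⁻ y, (NNReal.sqrt (u x y * T.density x y) : ℝ≥0∞) *
              ((1 + bracketWidth ν l u x) / affinity ν T.density u x) ∂(ν x) := by
              refine lintegral_mono fun y => ?_
              simp only [← mul_assoc]
              gcongr
              rw [← ENNReal.coe_mul, ENNReal.coe_le_coe]
              refine le_of_eq ?_
              -- Where t = 0 both sides vanish, so no null set has to be removed.
              rcases eq_or_ne (T.density x y) 0 with h0 | h0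
              · simp [h0]
              · rw [← NNReal.sqrt_mul_self (T.density x y), ← NNReal.sqrt_mul,
                  NNReal.sqrt_mul_self]
                congr 1
                field_simp
          _ = affinity ν T.density u x *
              ((1 + bracketWidth ν l u x) / affinity ν T.density u x) := by
              rw [lintegral_mul_const _ hs.coe_nnreal_ennreal, affinity]
          _ ≤ _ := ENNReal.mul_div_le
    _ = 1 + ∫⁻ x, bracketWidth ν l u x ∂ρ := by
        rw [lintegral_add_left measurable_const]; simp
    _ ≤ 1 + ENNReal.ofReal ε := by gcongr
    _ = ENNReal.ofReal (1 + ε) := by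
        rw [ENNReal.ofReal_add zero_le_one hε, ENNReal.ofReal_one]
    _ ≤ _ := ENNReal.ofReal_le_ofReal (by linarith [Real.add_one_le_exp ε])

/-! ### Independent data and almost sure properties -/

instance (ρ : Measure (S × A)) [IsProbabilityMeasure ρ] (T : Model ν) (n : ℕ) :
    IsProbabilityMeasure (datasetLaw ρ T n) := by
  unfold datasetLaw
  infer_instance

lemma lintegral_datasetLaw_prod (T : Model ν) (ρ : Measure (S × A)) [IsProbabilityMeasure ρ]
    (n : ℕ) {f : (S × A) × (S × ℝ) → ℝ≥0∞} (hf : Measurable f) :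
    ∫⁻ D, ∏ i, f (D i) ∂(datasetLaw ρ T n) = (∫⁻ z, f z ∂(ρ ⊗ₘ T.kernel)) ^ n := by
  unfold datasetLaw
  rw [lintegral_prod_eq_prod_lintegral_of_indepFun Finset.univ
    (fun (i : Fin n) (D : Fin n → (S × A) × (S × ℝ)) => f (D i))
    (iIndepFun_pi fun _ => hf.aemeasurable) fun i => hf.comp (measurable_pi_apply i)]
  have h : ∀ i : Fin n, ∫⁻ D, f (D i) ∂(Measure.pi fun _ : Fin n => ρ ⊗ₘ T.kernel) =
      ∫⁻ z, f z ∂(ρ ⊗ₘ T.kernel) := fun i =>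
    (measurePreserving_eval (fun _ : Fin n => ρ ⊗ₘ T.kernel) i).lintegral_comp hf
  simp [h]

lemma ae_datasetLaw_of_ae {T : Model ν} {ρ : Measure (S × A)} [IsProbabilityMeasure ρ]
    (n : ℕ) {p : (S × A) × (S × ℝ) → Prop} (hp : ∀ᵐ z ∂(ρ ⊗ₘ T.kernel), p z) :
    ∀ᵐ D ∂(datasetLaw ρ T n), ∀ i, p (D i) :=
  ae_all_iff.2 fun _ => Measure.tendsto_eval_ae_ae.eventually hp

lemma ae_density_pos (T : Model ν) (ρ : Measure (S × A)) [IsProbabilityMeasure ρ] :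
    ∀ᵐ z ∂(ρ ⊗ₘ T.kernel), 0 < T.density z.1 z.2 := by
  have hm : MeasurableSet {z : (S × A) × (S × ℝ) | 0 < T.density z.1 z.2} :=
    measurableSet_lt measurable_const T.measurable_density
  refine (Measure.ae_compProd_iff hm).2 (ae_of_all _ fun x => ?_)
  have htx : Measurable (T.density x) := T.measurable_density.comp measurable_prodMk_left
  rw [model_kernel_apply, ae_withDensity_iff htx.coe_nnreal_ennreal]
  exact ae_of_all _ fun y hy => pos_iff_ne_zero.2 (by simpa using hy)

lemma ae_bracketWidth_lt_top (T : Model ν) (ρ : Measure (S × A)) [IsProbabilityMeasure ρ]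
    {l u : S × A → S × ℝ → ℝ≥0} (hl : Measurable (Function.uncurry l))
    (hu : Measurable (Function.uncurry u)) (hw : ∫⁻ x, bracketWidth ν l u x ∂ρ ≠ ∞) :
    ∀ᵐ z ∂(ρ ⊗ₘ T.kernel), bracketWidth ν l u z.1 < ∞ := by
  have hwm := measurable_bracketWidth (ν := ν) hl hu
  have hm : MeasurableSet {z : (S × A) × (S × ℝ) | bracketWidth ν l u z.1 < ∞} :=
    measurableSet_lt (hwm.comp measurable_fst) measurable_const
  refine (Measure.ae_compProd_iff hm).2 ?_
  filter_upwards [ae_lt_top hwm hw] with x hx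
  exact ae_of_all _ fun _ => hx

/-- If `P` lies in the bracket `[l, u]` and its likelihood is at least that of `T`, the product of
the scores controls the total variation distance of `P` and `T` on the dataset. -/
lemma exp_sum_sq_tvDist_le_prod_bracketScore {P T : Model ν} {l u : S × A → S × ℝ → ℝ≥0}
    (hu : Measurable (Function.uncurry u))
    (hlP : ∀ x y, l x y ≤ P.density x y) (hPu : ∀ x y, P.density x y ≤ u x y) {n : ℕ}
    {D : Fin n → (S × A) × (S × ℝ)} (hD : ∀ i, 0 < T.density (D i).1 (D i).2)
    (hw : ∀ i, bracketWidth ν l u (D i).1 < ∞)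
    (hlik : ∏ i, T.density (D i).1 (D i).2 ≤ ∏ i, P.density (D i).1 (D i).2) :
    ENNReal.ofReal (Real.exp
        ((∑ i, tvDist (P.kernel (D i).1) (T.kernel (D i).1) ^ 2) / 16)) ≤
      ∏ i, bracketScore ν T.density l u (D i) := by
  have hone : 1 ≤ ∏ i, NNReal.sqrt (u (D i).1 (D i).2 / T.density (D i).1 (D i).2) := by
    have h := map_prod NNReal.sqrtHom
      (fun i => u (D i).1 (D i).2 / T.density (D i).1 (D i).2) Finset.univ
    change NNReal.sqrt _ = ∏ i, NNReal.sqrt _ at h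
    rw [← h, NNReal.one_le_sqrt, Finset.prod_div_distrib,
      one_le_div (Finset.prod_pos fun i _ => hD i)]
    exact hlik.trans (Finset.prod_le_prod' fun i _ => hPu _ _)
  have hx : ∀ i, ENNReal.ofReal (Real.exp
      (tvDist (P.kernel (D i).1) (T.kernel (D i).1) ^ 2 / 16)) ≤
      (1 + bracketWidth ν l u (D i).1) / affinity ν T.density u (D i).1 := fun i => by
    -- The numerator is nonzero and finite, so the affinity may be 0 or ∞.
    refine (ENNReal.le_div_iff_mul_le (.inr (by simp))
      (.inr (ENNReal.add_ne_top.2 ⟨ENNReal.one_ne_top, (hw i).ne⟩))).2 ?_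
    rw [model_kernel_apply, model_kernel_apply]
    exact exp_sq_tvDist_mul_affinity_le (P.measurable_density.comp measurable_prodMk_left)
      (T.measurable_density.comp measurable_prodMk_left) (hu.comp measurable_prodMk_left)
      (P.lintegral_density _) (T.lintegral_density _) (hlP _) (hPu _)
  rw [Finset.sum_div, Real.exp_sum, ENNReal.ofReal_prod_of_nonneg fun i _ => (Real.exp_pos _).le]
  simp only [bracketScore, Finset.prod_mul_distrib]
  calc _ ≤ ∏ i, (1 + bracketWidth ν l u (D i).1) / affinity ν T.density u (D i).1 :=
        Finset.prod_le_prod' fun i _ => hx i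
    _ ≤ _ := by
        refine le_mul_of_one_le_left' ?_
        rw [← ENNReal.ofNNReal_finsetProd]
        exact_mod_cast hone

/-- With probability at least `1 - δ`, the true model is within the given squared total variation
distance of every maximum likelihood estimate. -/
lemma exists_event_mem_plausibleModels {M : Set (Model ν)} {T : Model ν} (hT : T ∈ M)
    (ρ : Measure (S × A)) [IsProbabilityMeasure ρ] {n : ℕ} (hn : 0 < n) {δ : ℝ} (hδ : 0 < δ)
    {ε : ℝ} (hε : 0 ≤ ε) {N : ℕ} (hN : HasBracketing ρ M ε N) {ξ : ℝ}
    (hξ : 16 * (Real.log (N / δ) / n + ε) ≤ ξ) :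
    ∃ E : Set (Fin n → (S × A) × (S × ℝ)), MeasurableSet E ∧
      ENNReal.ofReal (1 - δ) ≤ datasetLaw ρ T n E ∧
      ∀ D ∈ E, ∀ Pmle : Model ν, IsMLE M D Pmle → T ∈ plausibleModels M ξ D Pmle := by
  obtain ⟨l, u, hm, -, hw, hcov⟩ := hN
  have hN0 : (0 : ℝ) < N := by
    obtain ⟨j, -⟩ := hcov T hT
    exact_mod_cast j.pos
  have hn0 : (0 : ℝ) < n := by exact_mod_cast hn
  have ht := T.measurable_density
  -- Markov threshold: a mean of at most exp(nε) leaves probability δ/N to each bracket.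
  set c : ℝ := N / δ * Real.exp (n * ε) with hc
  have hc0 : 0 < c := by positivity
  set G : Set (Fin n → (S × A) × (S × ℝ)) :=
    {D | (∀ i, 0 < T.density (D i).1 (D i).2) ∧ ∀ j i, bracketWidth ν (l j) (u j) (D i).1 < ∞}
    with hG
  set B : Fin N → Set (Fin n → (S × A) × (S × ℝ)) := fun j =>
    {D | ENNReal.ofReal c ≤ ∏ i, bracketScore ν T.density (l j) (u j) (D i)}
  have hpm : ∀ j, Measurable fun D : Fin n → (S × A) × (S × ℝ) =>
      ∏ i, bracketScore ν T.density (l j) (u j) (D i) := fun j =>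
    Finset.measurable_fun_prod _ fun i _ =>
      (measurable_bracketScore ht (hm j).1 (hm j).2).comp (measurable_pi_apply i)
  have hBm : ∀ j, MeasurableSet (B j) := fun j => measurableSet_le measurable_const (hpm j)
  have hGm : MeasurableSet G := by
    simp only [hG, Set.ofPred_and, Set.ofPred_forall]
    exact (MeasurableSet.iInter fun i => measurableSet_lt measurable_const
        (ht.comp (measurable_pi_apply i))).inter
      (MeasurableSet.iInter fun j => MeasurableSet.iInter fun i => measurableSet_lt
        ((measurable_bracketWidth (ν := ν) (hm j).1 (hm j).2).comp
          (measurable_fst.comp (measurable_pi_apply i))) measurable_const)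
  have hBμ : ∀ j, datasetLaw ρ T n (B j) ≤ ENNReal.ofReal (δ / N) := fun j => by
    refine (meas_ge_le_lintegral_div (hpm j).aemeasurable (by simpa using hc0)
      ENNReal.ofReal_ne_top).trans ?_
    rw [lintegral_datasetLaw_prod T ρ n (measurable_bracketScore ht (hm j).1 (hm j).2)]
    calc _ ≤ ENNReal.ofReal (Real.exp ε) ^ n / ENNReal.ofReal c := by
          gcongr
          exact lintegral_bracketScore_le T ρ (hm j).1 (hm j).2 hε (hw j)
      _ = ENNReal.ofReal (δ / N) := by
          rw [← ENNReal.ofReal_pow (Real.exp_pos _).le, ← ENNReal.ofReal_div_of_pos hc0,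
            ← Real.exp_nat_mul, hc]
          congr 1
          have := (Real.exp_pos (n * ε)).ne'
          field_simp
  have hGμ : datasetLaw ρ T n Gᶜ = 0 := by
    have h1 := ae_datasetLaw_of_ae n (ae_density_pos T ρ)
    have h2 : ∀ᵐ D ∂(datasetLaw ρ T n), ∀ j i, bracketWidth ν (l j) (u j) (D i).1 < ∞ :=
      ae_all_iff.2 fun j => ae_datasetLaw_of_ae n (ae_bracketWidth_lt_top T ρ (hm j).1 (hm j).2
        ((hw j).trans_lt ENNReal.ofReal_lt_top).ne)
    exact mem_ae_iff.1 (h1.and h2)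
  have hEm : MeasurableSet (Gᶜ ∪ ⋃ j, B j) := hGm.compl.union (.iUnion hBm)
  -- The bad events depend on brackets, not on the MLE, so one event serves every maximizer and no
  -- measurable selection is needed.
  refine ⟨(Gᶜ ∪ ⋃ j, B j)ᶜ, hEm.compl, ?_, fun D hD P hP => ⟨hT, ?_⟩⟩
  · rw [prob_compl_eq_one_sub hEm, ENNReal.ofReal_sub _ hδ.le, ENNReal.ofReal_one]
    refine tsub_le_tsub_left ?_ _
    calc _ ≤ datasetLaw ρ T n Gᶜ + ∑ j, datasetLaw ρ T n (B j) :=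
          (measure_union_le _ _).trans (by gcongr; exact measure_iUnion_fintype_le _ _)
      _ ≤ 0 + ∑ _j : Fin N, ENNReal.ofReal (δ / N) := by
          rw [hGμ]; gcongr with j; exact hBμ j
      _ = ENNReal.ofReal δ := by
          rw [zero_add, Finset.sum_const, Finset.card_univ, Fintype.card_fin, nsmul_eq_mul,
            ← ENNReal.ofReal_natCast, ← ENNReal.ofReal_mul hN0.le]
          congr 1
          field_simp
  · simp only [Set.compl_union, compl_compl, Set.mem_inter_iff, Set.compl_iUnion,
      Set.mem_iInter] at hD
    obtain ⟨⟨hpos, hfin⟩, hlt⟩ := hD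
    obtain ⟨j, hj⟩ := hcov P hP.1
    have h1 := exp_sum_sq_tvDist_le_prod_bracketScore (hm j).2 (fun x y => (hj x y).1)
      (fun x y => (hj x y).2) hpos (hfin j) (hP.2 T hT)
    have h2 := (ENNReal.ofReal_lt_ofReal_iff hc0).1 (h1.trans_lt (not_le.1 (hlt j)))
    rw [← Real.lt_log_iff_exp_lt hc0, hc, Real.log_mul (by positivity) (Real.exp_pos _).ne', Real.log_exp] at h2
    rw [div_le_iff₀ hn0]
    have h3 : 16 * (Real.log (N / δ) / n + ε) * n = 16 * (Real.log (N / δ) + n * ε) := by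
      field_simp
    nlinarith [mul_le_mul_of_nonneg_right hξ hn0.le]

end

end OfflineRL

theorem proposition1 {S A : Type*} [MeasurableSpace S] [MeasurableSpace A]
    (ν : Kernel (S × A) (S × ℝ)) [IsSFiniteKernel ν]
    (μ₀ : Measure S) [IsProbabilityMeasure μ₀] (γ : ℝ) (hγ : γ ∈ Set.Ioo (0 : ℝ) 1)
    (M : Set (OfflineRL.Model ν)) (T : OfflineRL.Model ν) (hT : T ∈ M)
    (ρ : Measure (S × A)) [IsProbabilityMeasure ρ]
    (n : ℕ) (hn : 0 < n) (δ : ℝ) (hδ : δ ∈ Set.Ioo (0 : ℝ) 1)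
    (ε : ℝ) (hε : 0 ≤ ε) (N : ℕ) (hN : OfflineRL.HasBracketing ρ M ε N)
    (ξ : ℝ) (hξ : 16 * (Real.log (2 * N / δ) / n + ε) ≤ ξ)
    (π : Kernel S A) [IsMarkovKernel π]
    (hV : ∀ P ∈ M, OfflineRL.HasValue μ₀ γ π P) :
    ∃ E : Set (Fin n → (S × A) × (S × ℝ)), MeasurableSet E ∧
      ENNReal.ofReal (1 - δ) ≤ OfflineRL.datasetLaw ρ T n E ∧
      ∀ D ∈ E, ∀ Pmle : OfflineRL.Model ν, OfflineRL.IsMLE M D Pmle →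
        (⨅ P ∈ OfflineRL.plausibleModels M ξ D Pmle, (OfflineRL.value μ₀ γ π P : EReal)) ≤
          (OfflineRL.value μ₀ γ π T : EReal) := by
  have hN0 : (0 : ℝ) < N := by
    obtain ⟨_, _, -, -, -, hcov⟩ := hN
    obtain ⟨j, -⟩ := hcov T hT
    exact_mod_cast j.pos
  have hδ0 : 0 < δ := hδ.1
  -- The factor 2 inside the logarithm is slack.
  have hξ' : 16 * (Real.log (N / δ) / n + ε) ≤ ξ := by
    refine le_trans ?_ hξ
    gcongr
    linarith
  obtain ⟨E, hEm, hE, h⟩ := OfflineRL.exists_event_mem_plausibleModels hT ρ hn hδ0 hε hN hξ'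
  -- In `EReal` the infimum needs no lower bound on the values.
  exact ⟨E, hEm, hE, fun D hD P hP => iInf₂_le T (h D hD P hP)⟩
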